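/- Let $X$ be a finite dimensional real normed space and let $\mathrm{Iso}(X)$ be its group of isometries. By the Mazur--Ulam theorem every isometry of $X$ is affine; $\mathrm{Iso}(X)$ carries the topology and smooth structure of a closed submanifold of the finite dimensional space $A(X)$ of affine maps $X \to X$. Let $S$ be a set and let $p = (p_v)_{v\in S} \in X^S$ be a placement of $S$ in $X$. Write $g.p := (g(p_v))_{v \in S}$ for an affine map $g$, and $\mathcal{O}_p := \{g.p : g \in \mathrm{Iso}(X)\} \subseteq X^S$ for the orbit of $p$, which is a smooth submanifold of the finite dimensional linear space $\{h.p : h \in A(X)\}$. Suppose that $p$ is isometrically full, i.e. the map $\phi_p : \mathrm{Iso}(X) \to \mathcal{O}_p$, $g \mapsto g.p$, is a smooth diffeomorphism. Let $\delta > 0$ and let $\alpha = (\alpha_v)_{v \in S}$ be a continuous path through $p$, i.e. a family of continuous maps $\alpha_v : (-\delta,\delta) \to X$ with $\alpha_v(0) = p_v$ for all $v \in S$. Then the following are equivalent: (i) $\alpha$ is a trivial finite motion, i.e. $(\alpha_v(t))_{v \in S} \in \mathcal{O}_p$ for all $t \in (-\delta,\delta)$. (ii) There exists a unique continuous path $h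 : (-\delta,\delta) \to \mathrm{Iso}(X)$ such that $h_t(p_v) = \alpha_v(t)$ for all $t \in (-\delta,\delta)$ and $v \in S$. (iii) There exists a unique rigid motion $\gamma$ of $X$ on $(-\delta,\delta)$ such that $\gamma_{p_v} = \alpha_v$ for all $v \in S$. Here a rigid motion of $X$ on $(-\delta,\delta)$ is a family $\gamma = (\gamma_x)_{x \in X}$ of continuous maps $\gamma_x : (-\delta,\delta) \to X$ with $\gamma_x(0) = x$ and $\|\gamma_x(t) - \gamma_y(t)\| = \|x - y\|$ for all $x,y \in X$ and $t \in (-\delta,\delta)$. -/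

import Mathlib

open scoped ContDiff

/-! ### The isometry group and its topology -/

/-- The space `A(X)` of (continuous) affine maps of a finite dimensional normed space is finite
dimensional. -/
instance affineMaps_finiteDimensional (X : Type*) [NormedAddCommGroup X] [NormedSpace ℝ X]
    [FiniteDimensional ℝ X] : FiniteDimensional ℝ (X →ᴬ[ℝ] X) :=
  LinearEquiv.finiteDimensional
    (ContinuousAffineMap.decompLinearIsometryEquiv ℝ ℝ X X).symm.toLinearEquiv

/-- An isometry of a real normed space is affine (Mazur-Ulam); this is the resulting inclusion
`Iso(X) → A(X)`. -/
noncomputable def isoToAffine {X : Type*} [NormedAddCommGroup X] [NormedSpace ℝ X]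
    (g : X ≃ᵢ X) : X →ᴬ[ℝ] X :=
  { toAffineMap := g.toRealAffineIsometryEquiv.toAffineEquiv.toAffineMap
    cont := g.continuous }

theorem isoToAffine_apply {X : Type*} [NormedAddCommGroup X] [NormedSpace ℝ X]
    (g : X ≃ᵢ X) (x : X) : isoToAffine g x = g x := rfl

/-- The topology of `Iso(X)` is inherited from the norm topology of `A(X)`. -/
noncomputable instance isoTopologicalSpace (X : Type*) [NormedAddCommGroup X] [NormedSpace ℝ X] :
    TopologicalSpace (X ≃ᵢ X) :=
  TopologicalSpace.induced isoToAffine inferInstance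

/-! ### Smooth maps between subsets of finite dimensional vector spaces -/

/-- `F` is `C^∞` on the set `U`, for a map between finite dimensional Hausdorff topological
vector spaces. Such a space carries no preferred norm, so the condition is read in linear
coordinates; it does not depend on the coordinates. -/
def SmoothOnSet {V W : Type*}
    [AddCommGroup V] [TopologicalSpace V] [IsTopologicalAddGroup V] [T2Space V]
    [Module ℝ V] [ContinuousSMul ℝ V] [FiniteDimensional ℝ V]
    [AddCommGroup W] [TopologicalSpace W] [IsTopologicalAddGroup W] [T2Space W]
    [Module ℝ W] [ContinuousSMul ℝ W] [FiniteDimensional ℝ W]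
    (F : V → W) (U : Set V) : Prop :=
  ContDiffOn ℝ ∞ (fun y => toEuclidean (F (toEuclidean.symm y)))
    ((toEuclidean (E := V)).symm ⁻¹' U)

/-- Let `i : M → V` and `j : N → W` be the inclusions of two subsets of finite dimensional
vector spaces. A map `f : M → N` is smooth if near each point of `M` it is the restriction of a
`C^∞` map defined on an open subset of `V`. When `M` and `N` are embedded submanifolds these are
exactly the smooth maps of manifolds. -/
def IsSmoothBetween {M N V W : Type*}
    [AddCommGroup V] [TopologicalSpace V] [IsTopologicalAddGroup V] [T2Space V]
    [Module ℝ V] [ContinuousSMul ℝ V] [FiniteDimensional ℝ V]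
    [AddCommGroup W] [TopologicalSpace W] [IsTopologicalAddGroup W] [T2Space W]
    [Module ℝ W] [ContinuousSMul ℝ W] [FiniteDimensional ℝ W]
    (i : M → V) (j : N → W) (f : M → N) : Prop :=
  ∀ x : M, ∃ U : Set V, IsOpen U ∧ i x ∈ U ∧
    ∃ F : V → W, SmoothOnSet F U ∧ ∀ y : M, i y ∈ U → F (i y) = j (f y)

/-- A smooth diffeomorphism: a smooth map with a smooth two-sided inverse. -/
def IsSmoothDiffeo {M N V W : Type*}
    [AddCommGroup V] [TopologicalSpace V] [IsTopologicalAddGroup V] [T2Space V]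
    [Module ℝ V] [ContinuousSMul ℝ V] [FiniteDimensional ℝ V]
    [AddCommGroup W] [TopologicalSpace W] [IsTopologicalAddGroup W] [T2Space W]
    [Module ℝ W] [ContinuousSMul ℝ W] [FiniteDimensional ℝ W]
    (i : M → V) (j : N → W) (f : M → N) : Prop :=
  IsSmoothBetween i j f ∧
    ∃ f' : N → M, Function.LeftInverse f' f ∧ Function.RightInverse f' f ∧
      IsSmoothBetween j i f'

/-! ### Placements -/

/-- The orbit `𝒪_p = {g.p : g ∈ Iso(X)} ⊆ X^S` of a placement `p`, where `g.p = (g(p_v))_v`. -/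
def placementOrbit {X S : Type*} [NormedAddCommGroup X] [NormedSpace ℝ X]
    (p : S → X) : Set (S → X) :=
  {q | ∃ g : X ≃ᵢ X, q = fun v => g (p v)}

/-- The map `φ_p : Iso(X) → 𝒪_p`, `g ↦ g.p`. -/
def orbitMap {X S : Type*} [NormedAddCommGroup X] [NormedSpace ℝ X]
    (p : S → X) (g : X ≃ᵢ X) : placementOrbit p :=
  ⟨fun v => g (p v), g, rfl⟩

/-- The linear map `A(X) → X^S`, `h ↦ h.p`. -/
def affineAct {X S : Type*} [NormedAddCommGroup X] [NormedSpace ℝ X]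
    (p : S → X) : (X →ᴬ[ℝ] X) →ₗ[ℝ] (S → X) where
  toFun h := fun v => h (p v)
  map_add' _ _ := rfl
  map_smul' _ _ := rfl

/-- The finite dimensional linear subspace `{h.p : h ∈ A(X)}` of `X^S`, with the topology
inherited from the product topology. It contains the orbit of `p`. -/
abbrev affineOrbit {X S : Type*} [NormedAddCommGroup X] [NormedSpace ℝ X]
    (p : S → X) : Submodule ℝ (S → X) :=
  LinearMap.range (affineAct p)

theorem placementOrbit_subset {X S : Type*} [NormedAddCommGroup X] [NormedSpace ℝ X]
    (p : S → X) {q : S → X} (hq : q ∈ placementOrbit p) : q ∈ affineOrbit p := by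
  obtain ⟨g, rfl⟩ := hq
  exact ⟨isoToAffine g, rfl⟩

/-- The inclusion of the orbit of `p` into `{h.p : h ∈ A(X)}`. -/
def orbitInclusion {X S : Type*} [NormedAddCommGroup X] [NormedSpace ℝ X]
    (p : S → X) (q : placementOrbit p) : affineOrbit p :=
  ⟨q.1, placementOrbit_subset p q.2⟩

/-- A placement `p` is isometrically full if `φ_p : Iso(X) → 𝒪_p` is a smooth diffeomorphism.
`Iso(X)` is a submanifold of `A(X)`. The set `S` may be infinite, in which case `X^S` is not
normable; the manifold structure of `𝒪_p` is that of a submanifold of the finite dimensional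
space `{h.p : h ∈ A(X)}`, which for finite `S` is the same as that of a submanifold of `X^S`. -/
def IsometricallyFull {X S : Type*} [NormedAddCommGroup X] [NormedSpace ℝ X]
    [FiniteDimensional ℝ X] (p : S → X) : Prop :=
  IsSmoothDiffeo (isoToAffine (X := X)) (orbitInclusion p) (orbitMap p)

/-- A continuous path through `p`: continuous `α_v : (-δ, δ) → X` with `α_v(0) = p_v`. -/
structure IsContinuousPathThrough {X S : Type*} [NormedAddCommGroup X] [NormedSpace ℝ X]
    (p : S → X) (δ : ℝ) (α : S → Set.Ioo (-δ) δ → X) : Prop where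
  continuous : ∀ v, Continuous (α v)
  at_zero : ∀ v, ∀ t : Set.Ioo (-δ) δ, (t : ℝ) = 0 → α v t = p v

/-- A trivial finite motion of `p`: a continuous path through `p` that stays in the orbit. -/
structure IsTrivialFiniteMotion {X S : Type*} [NormedAddCommGroup X] [NormedSpace ℝ X]
    (p : S → X) (δ : ℝ) (α : S → Set.Ioo (-δ) δ → X) : Prop where
  path : IsContinuousPathThrough p δ α
  mem_orbit : ∀ t, (fun v => α v t) ∈ placementOrbit p

/-- A rigid motion of `X`: continuous `γ_x : (-δ, δ) → X` for `x ∈ X`, with `γ_x(0) = x` and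
`‖γ_x(t) - γ_y(t)‖ = ‖x - y‖`. -/
structure IsRigidMotion {X : Type*} [NormedAddCommGroup X] [NormedSpace ℝ X]
    (δ : ℝ) (γ : X → Set.Ioo (-δ) δ → X) : Prop where
  continuous : ∀ x, Continuous (γ x)
  at_zero : ∀ x, ∀ t : Set.Ioo (-δ) δ, (t : ℝ) = 0 → γ x t = x
  isometric : ∀ x y t, ‖γ x t - γ y t‖ = ‖x - y‖

/-! Fullness enters in two ways. Injectivity of `φ_p` means that an isometry is determined by its
values on `p`, which gives both uniqueness claims. Continuity of `φ_p⁻¹` makes `t ↦ φ_p⁻¹(α(t))` a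
continuous path in `Iso(X)` whenever `α` stays in the orbit. Evaluating such a path at points of `X`
gives a rigid motion. Conversely, each time slice of a rigid motion is a distance-preserving
self-map of `X`; it is onto because closed balls are compact, so it lies in `Iso(X)` and `α(t)` lies
in the orbit. -/

/-- An isometric self-map of a compact set is onto. -/
theorem Isometry.surjOn_of_isCompact {X : Type*} [MetricSpace X] {f : X → X} (hf : Isometry f)
    {K : Set X} (hK : IsCompact K) (hm : Set.MapsTo f K K) : Set.SurjOn f K K := by
  intro x hx
  by_contra hne
  have hcl : IsClosed (f '' K) := (hK.image hf.continuous).isClosed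
  -- The image misses a ball of radius `ε` about `x`, so the iterates of `x` are pairwise at least
  -- `ε` apart, and no subsequence can be Cauchy.
  obtain ⟨ε, hε, hball⟩ := Metric.isOpen_iff.1 hcl.isOpen_compl x hne
  have hfar : ∀ y ∈ K, ε ≤ dist (f y) x := fun y hy => by
    by_contra! hlt
    exact hball (Metric.mem_ball.2 hlt) ⟨y, hy, rfl⟩
  have hmem : ∀ n, f^[n] x ∈ K := fun n => hm.iterate n hx
  have hiso : ∀ n, Isometry f^[n] := fun n => by
    induction n with
    | zero => exact isometry_id
    | succ n ih => exact ih.comp hf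
  have hsep : ∀ m n, m < n → ε ≤ dist (f^[n] x) (f^[m] x) := fun m n hmn => by
    obtain ⟨k, rfl⟩ := Nat.exists_eq_add_of_lt hmn
    rw [show m + k + 1 = m + (k + 1) by ring, Function.iterate_add_apply, (hiso m).dist_eq,
      Function.iterate_succ_apply']
    exact hfar _ (hmem k)
  obtain ⟨a, -, φ, hφ, hlim⟩ := hK.tendsto_subseq hmem
  obtain ⟨N, hN⟩ := Metric.cauchySeq_iff'.1 hlim.cauchySeq ε hε
  exact (hN (N + 1) (Nat.le_succ N)).not_ge (hsep _ _ (hφ (Nat.lt_succ_self N)))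

/-- An isometric self-map of a finite dimensional normed space is onto. -/
theorem Isometry.surjective_of_finiteDimensional {X : Type*} [NormedAddCommGroup X]
    [NormedSpace ℝ X] [FiniteDimensional ℝ X] {f : X → X} (hf : Isometry f) :
    Function.Surjective f := by
  have : ProperSpace X := FiniteDimensional.proper ℝ X
  intro y
  -- Once translated to fix `0`, the map preserves norms and hence every ball about `0`; the radius
  -- is chosen so that the ball contains the target `y - f 0`.
  have hg : Isometry fun x => f x - f 0 := by
    refine Isometry.of_dist_eq fun a b => ?_
    rw [dist_sub_right, hf.dist_eq]
  have hm : Set.MapsTo (fun x => f x - f 0) (Metric.closedBall 0 ‖y - f 0‖)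
      (Metric.closedBall 0 ‖y - f 0‖) := by
    intro x hx
    have h := hf.dist_eq x 0
    rw [mem_closedBall_zero_iff] at hx ⊢
    rw [dist_eq_norm, dist_zero_right] at h
    rwa [h]
  obtain ⟨x, -, hx⟩ := hg.surjOn_of_isCompact (isCompact_closedBall 0 ‖y - f 0‖) hm
    (show y - f 0 ∈ _ by simp)
  exact ⟨x, sub_left_injective hx⟩

theorem SmoothOnSet.continuousOn {V W : Type*}
    [AddCommGroup V] [TopologicalSpace V] [IsTopologicalAddGroup V] [T2Space V]
    [Module ℝ V] [ContinuousSMul ℝ V] [FiniteDimensional ℝ V]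
    [AddCommGroup W] [TopologicalSpace W] [IsTopologicalAddGroup W] [T2Space W]
    [Module ℝ W] [ContinuousSMul ℝ W] [FiniteDimensional ℝ W]
    {F : V → W} {U : Set V} (hF : SmoothOnSet F U) : ContinuousOn F U := by
  have h := ContDiffOn.continuousOn hF
  have h' : ContinuousOn (fun y : V => (toEuclidean (E := W)).symm
      (toEuclidean (F (toEuclidean.symm (toEuclidean y))))) U :=
    (toEuclidean (E := W)).symm.continuous.comp_continuousOn
      (h.comp (toEuclidean (E := V)).continuous.continuousOn fun y hy => by simpa using hy)
  simpa using h'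

/-- A smooth map between subsets sends continuous families to continuous families. -/
theorem IsSmoothBetween.continuous_comp {M N V W T : Type*}
    [AddCommGroup V] [TopologicalSpace V] [IsTopologicalAddGroup V] [T2Space V]
    [Module ℝ V] [ContinuousSMul ℝ V] [FiniteDimensional ℝ V]
    [AddCommGroup W] [TopologicalSpace W] [IsTopologicalAddGroup W] [T2Space W]
    [Module ℝ W] [ContinuousSMul ℝ W] [FiniteDimensional ℝ W] [TopologicalSpace T]
    {i : M → V} {j : N → W} {f : M → N} (hf : IsSmoothBetween i j f) {q : T → M}
    (hq : Continuous fun t => i (q t)) : Continuous fun t => j (f (q t)) := by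
  refine continuous_iff_continuousAt.2 fun t => ?_
  obtain ⟨U, hU, ht, F, hF, hFf⟩ := hf (q t)
  have hc : ContinuousAt (fun s => F (i (q s))) t :=
    ContinuousAt.comp (f := fun s => i (q s)) (hF.continuousOn.continuousAt (hU.mem_nhds ht))
      hq.continuousAt
  refine hc.congr ?_
  filter_upwards [hq.continuousAt (hU.mem_nhds ht)] with s hs using hFf _ hs

section

variable {X S : Type*} [NormedAddCommGroup X] [NormedSpace ℝ X]

/-- Evaluation at `x` is the restriction of a linear map on the finite dimensional space `A(X)`. -/
theorem IsometryEquiv.continuous_eval [FiniteDimensional ℝ X] (x : X) :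
    Continuous fun g : X ≃ᵢ X => g x := by
  have h : Continuous (affineAct (id : X → X)) := LinearMap.continuous_of_finiteDimensional _
  exact ((continuous_apply x).comp h).comp
    (continuous_induced_dom : Continuous (isoToAffine (X := X)))

variable [FiniteDimensional ℝ X] {p : S → X}

theorem IsometricallyFull.isometryEquiv_ext (hp : IsometricallyFull p) {g g' : X ≃ᵢ X}
    (h : ∀ v, g (p v) = g' (p v)) : g = g' := by
  obtain ⟨-, f', hl, -, -⟩ := hp
  exact hl.injective (Subtype.ext (funext h))

/-- A continuous path in the orbit of an isometrically full placement lifts to a continuous path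
of isometries. -/
theorem IsometricallyFull.exists_continuous_lift (hp : IsometricallyFull p) {T : Type*}
    [TopologicalSpace T] {α : S → T → X} (hα : ∀ v, Continuous (α v))
    (hmem : ∀ t, (fun v => α v t) ∈ placementOrbit p) :
    ∃ h : T → (X ≃ᵢ X), Continuous h ∧ ∀ t v, h t (p v) = α v t := by
  obtain ⟨-, f', -, hr, hs⟩ := hp
  -- Both topologies are induced: continuity into `Iso(X)` is tested in `A(X)`, and continuity into
  -- the orbit coordinatewise in `X^S`.
  refine ⟨fun t => f' ⟨_, hmem t⟩, continuous_induced_rng.2 ?_, fun t v => ?_⟩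
  · exact hs.continuous_comp (q := fun t => (⟨_, hmem t⟩ : placementOrbit p))
      (Continuous.subtype_mk (continuous_pi hα) _)
  · exact congrFun (congrArg Subtype.val (hr ⟨_, hmem t⟩)) v

/-- At each time a rigid motion is an isometry of the whole space. -/
theorem IsRigidMotion.exists_isometryEquiv {δ : ℝ} {γ : X → Set.Ioo (-δ) δ → X}
    (hγ : IsRigidMotion δ γ) (t : Set.Ioo (-δ) δ) : ∃ g : X ≃ᵢ X, ∀ x, g x = γ x t := by
  have hi : Isometry fun x => γ x t :=
    Isometry.of_dist_eq fun x y => by simpa only [dist_eq_norm] using hγ.isometric x y t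
  exact ⟨⟨Equiv.ofBijective _ ⟨hi.injective, hi.surjective_of_finiteDimensional⟩, hi⟩,
    fun _ => rfl⟩

end

theorem mainTheorem11 {X S : Type*} [NormedAddCommGroup X] [NormedSpace ℝ X]
    [FiniteDimensional ℝ X] (p : S → X) (hp : IsometricallyFull p)
    (δ : ℝ) (hδ : 0 < δ) (α : S → Set.Ioo (-δ) δ → X)
    (hα : IsContinuousPathThrough p δ α) :
    List.TFAE [
      IsTrivialFiniteMotion p δ α,
      ∃! h : Set.Ioo (-δ) δ → (X ≃ᵢ X), Continuous h ∧ ∀ t v, h t (p v) = α v t,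
      ∃! γ : X → Set.Ioo (-δ) δ → X, IsRigidMotion δ γ ∧ ∀ v, γ (p v) = α v] := by
  tfae_have 1 → 2 := by
    intro hm
    obtain ⟨h, hc, hh⟩ := hp.exists_continuous_lift hα.continuous hm.mem_orbit
    refine ⟨h, ⟨hc, hh⟩, fun h' hh' => funext fun t => hp.isometryEquiv_ext fun v => ?_⟩
    rw [hh'.2, hh]
  tfae_have 2 → 3 := by
    rintro ⟨h, ⟨hc, hh⟩, -⟩
    refine ⟨fun x t => h t x, ⟨⟨fun x => (IsometryEquiv.continuous_eval x).comp hc, ?_, ?_⟩,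
      fun v => funext fun t => hh t v⟩, ?_⟩
    · intro x t ht
      -- At time `0` both isometries fix every `p v`.
      have h1 : h t = IsometryEquiv.refl X := hp.isometryEquiv_ext fun v => by
        rw [hh, hα.at_zero v t ht]; rfl
      change h t x = x
      rw [h1]
      rfl
    · intro x y t
      simpa only [dist_eq_norm] using (h t).dist_eq x y
    · rintro γ ⟨hγ, hγp⟩
      funext x t
      -- Uniqueness is settled separately at each time, so no continuity of `t ↦ g` is needed.
      obtain ⟨g, hg⟩ := hγ.exists_isometryEquiv t
      have hgh : g = h t := hp.isometryEquiv_ext fun v => by rw [hg, hγp, hh]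
      rw [← hg, hgh]
  tfae_have 3 → 1 := by
    rintro ⟨γ, ⟨hγ, hγp⟩, -⟩
    refine ⟨hα, fun t => ?_⟩
    obtain ⟨g, hg⟩ := hγ.exists_isometryEquiv t
    exact ⟨g, funext fun v => by rw [hg, hγp]⟩
  tfae_finish
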